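/- Let $x_1^s,\dots,x_{n^s}^s\in\mathbb R^{d_x}$ be source samples with labels $y_i^s\in\{1,\dots,K\}$, let $x_1^t,\dots,x_{n^t}^t\in\mathbb R^{d_x}$ be target samples ($n^s,n^t\ge 1$), let $P\subseteq\{1,\dots,n^t\}$ index the pseudo-labeled target samples, with pseudo-labels $\hat y_j^t\in\{1,\dots,K\}$, let $\omega(k)\in\mathbb R$ be class weights, and let $\mu\in(0,1)$, $\lambda>0$; all of these are fixed. The feature extractor, the classifier and the estimate network are the linear maps $x\mapsto\theta_{\sf E}x$, $z\mapsto\theta_{\sf C}z$, $z\mapsto\theta_{\sf T}z$ with $\theta_{\sf E}\in\mathbb R^{d_z\times d_x}$, $\theta_{\sf C}\in\mathbb R^{K\times d_z}$, $\theta_{\sf T}\in\mathbb R^{1\times d_z}$. With the softmax $\delta$ and the cross-entropy $\mathsf H(p,y)=-\log p_y$, consider $$\min_{(\theta_{\sf E},\theta_{\sf C})\in\mathcal E\times\mathcal C}\ \max_{\theta_{\sf T}\in\mathcal T}\ \mathcal L(\theta_{\sf E},\theta_{\sf C},\theta_{\sf T}),$$ $$\mathcal L=\frac{\mu}{n^s}\sum_{i=1}^{n^s}\omega(y_i^s)\,\mathsf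 H\big(\delta(\theta_{\sf C}\theta_{\sf E}x_i^s),y_i^s\big)+\frac{1-\mu}{|P|}\sum_{j\in P}\omega(\hat y_j^t)\,\mathsf H\big(\delta(\theta_{\sf C}\theta_{\sf E}x_j^t),\hat y_j^t\big)+\lambda\,\zeta(\theta_{\sf T},\theta_{\sf E}),$$ $$\zeta(\theta_{\sf T},\theta_{\sf E})=\frac1{n^s}\sum_{i=1}^{n^s}\theta_{\sf T}\theta_{\sf E}x_i^s-\log\Big[\frac1{n^t}\sum_{j=1}^{n^t}e^{\theta_{\sf T}\theta_{\sf E}x_j^t}\Big],$$ where $\mathcal E,\mathcal C,\mathcal T$ are nonempty convex compact sets (the second sum is $0$ if $P=\emptyset$). Matrices carry the Frobenius norm and products the Euclidean norm. Gradient ascent-descent (GAD) training with $m\ge1$ inner steps and step sizes $\eta_{\sf T},\eta>0$ starts at a point of $\mathcal E\times\mathcal C\times\mathcal T$. In each pass it performs $m$ times $\theta_{\sf T}\gets\Pi_{\mathcal T}(\theta_{\sf T}+\eta_{\sf T}\nabla_{\theta_{\sf T}}\zeta)$ and then, with both gradients computed at the current $(\theta_{\sf E},\theta_{\sf C})$ and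 the new $\theta_{\sf T}$, $\theta_{\sf E}\gets\Pi_{\mathcal E}(\theta_{\sf E}-\eta\nabla_{\theta_{\sf E}}\mathcal L)$ and $\theta_{\sf C}\gets\Pi_{\mathcal C}(\theta_{\sf C}-\eta\nabla_{\theta_{\sf C}}\mathcal L)$, where $\Pi$ is the Euclidean projection (it has no effect on an update that does not leave the set). Let $x_t=(\theta_{\sf E},\theta_{\sf C})$ after $t$ passes. Let $\Phi(x)=\max_{\theta_{\sf T}\in\mathcal T}\mathcal L(x,\theta_{\sf T})$ and, for $\nu>0$, let $\Phi_{1/2\nu}(x)=\min_{w\in\mathcal E\times\mathcal C}\{\Phi(w)+\nu\|w-x\|^2\}$ be its Moreau envelope. If $\mathcal L$ is $\nu$-smooth, i.e. has a $\nu$-Lipschitz gradient on $\mathcal E\times\mathcal C\times\mathcal T$, then $x\in\mathcal E\times\mathcal C$ is called an $\varepsilon$-stationary point of the minimax problem if $\Phi_{1/2\nu}$ is differentiable at $x$ and $\|\nabla\Phi_{1/2\nu}(x)\|\le\varepsilon$. Theorem. $\mathcal L$ is $\nu$-smooth on $\mathcal E\times\mathcal C\times\mathcal T$ for some $\nu>0$.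 For every such $\nu$, every $\varepsilon>0$ and every $\eta_{\sf T}\in(0,\lambda/\nu]$ there is $\eta_{\max}>0$ such that for every $\eta\in(0,\eta_{\max}]$ GAD training converges to an $\varepsilon$-stationary point in the following sense: there is $N\ge1$ such that, for every starting point in $\mathcal E\times\mathcal C\times\mathcal T$, some $x_t$ with $t<N$ is $\varepsilon$-stationary, $\Phi_{1/2\nu}$ is differentiable at all the $x_t$, and $$\frac1n\sum_{t=0}^{n-1}\|\nabla\Phi_{1/2\nu}(x_t)\|^2\le\varepsilon^2\qquad\text{for all }n\ge N.$$ -/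

import Mathlib

open Finset
open scoped Matrix

noncomputable section

namespace GAD

/-- Parameters of the linear feature extractor, a `dz × dx` matrix (Frobenius norm). -/
abbrev ExtractorParam (dx dz : ℕ) : Type := EuclideanSpace ℝ (Fin dz × Fin dx)

/-- Parameters of the linear classifier, a `K × dz` matrix (Frobenius norm). -/
abbrev ClassifierParam (dz K : ℕ) : Type := EuclideanSpace ℝ (Fin K × Fin dz)

/-- Parameters of the linear estimate network, a row vector of length `dz`. -/
abbrev EstimatorParam (dz : ℕ) : Type := EuclideanSpace ℝ (Fin dz)

/-- The minimization variable `(θ_E, θ_C)`, with the Euclidean norm of the product. -/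
abbrev MinVar (dx dz K : ℕ) : Type :=
  WithLp 2 (ExtractorParam dx dz × ClassifierParam dz K)

/-- All the variables `((θ_E, θ_C), θ_T)`, with the Euclidean norm of the product. -/
abbrev JointVar (dx dz K : ℕ) : Type :=
  WithLp 2 (MinVar dx dz K × EstimatorParam dz)

/-- The linear extractor `x ↦ θ_E x`. -/
def extractor {dx dz : ℕ} (θE : ExtractorParam dx dz) (x : Fin dx → ℝ) : Fin dz → ℝ :=
  (Matrix.of fun i j => θE (i, j)) *ᵥ x

/-- The linear classifier `z ↦ θ_C z` (its output is fed to the softmax). -/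
def classifier {dz K : ℕ} (θC : ClassifierParam dz K) (z : Fin dz → ℝ) : Fin K → ℝ :=
  (Matrix.of fun i j => θC (i, j)) *ᵥ z

/-- The linear estimate network `z ↦ θ_T z`. -/
def estimator {dz : ℕ} (θT : EstimatorParam dz) (z : Fin dz → ℝ) : ℝ :=
  ∑ i, θT i * z i

/-- The softmax function. -/
def softmax {K : ℕ} (v : Fin K → ℝ) : Fin K → ℝ :=
  fun k => Real.exp (v k) / ∑ j, Real.exp (v j)

/-- The cross-entropy between a probability vector and the one-hot vector of a label. -/
def crossEntropy {K : ℕ} (p : Fin K → ℝ) (y : Fin K) : ℝ :=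
  -∑ k, (Pi.single y (1 : ℝ) : Fin K → ℝ) k * Real.log (p k)

/-- The data that determine the loss: source samples with labels, target samples, the set of
the target samples that are pseudo-labeled with their pseudo-labels (values of `yhat` outside
`pseudo` are never used), the class weights and the hyperparameters `μ` and `lam` (`λ`). -/
structure Data (dx K ns nt : ℕ) where
  xs : Fin ns → Fin dx → ℝ
  ys : Fin ns → Fin K
  xt : Fin nt → Fin dx → ℝ
  pseudo : Finset (Fin nt)
  yhat : Fin nt → Fin K
  ω : Fin K → ℝ
  μ : ℝ
  lam : ℝ

section Loss

variable {dx dz K ns nt : ℕ}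

/-- Weighted cross-entropy on the source samples. -/
def sourceLoss (D : Data dx K ns nt) (θE : ExtractorParam dx dz)
    (θC : ClassifierParam dz K) : ℝ :=
  (1 / (ns : ℝ)) * ∑ i, D.ω (D.ys i) *
    crossEntropy (softmax (classifier θC (extractor θE (D.xs i)))) (D.ys i)

/-- Weighted cross-entropy on the pseudo-labeled target samples (zero if there are none). -/
def targetLoss (D : Data dx K ns nt) (θE : ExtractorParam dx dz)
    (θC : ClassifierParam dz K) : ℝ :=
  (1 / (D.pseudo.card : ℝ)) * ∑ i ∈ D.pseudo, D.ω (D.yhat i) *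
    crossEntropy (softmax (classifier θC (extractor θE (D.xt i)))) (D.yhat i)

/-- The sample version of the Donsker-Varadhan functional. -/
def zeta (D : Data dx K ns nt) (θT : EstimatorParam dz) (θE : ExtractorParam dx dz) : ℝ :=
  (1 / (ns : ℝ)) * ∑ i, estimator θT (extractor θE (D.xs i)) -
    Real.log ((1 / (nt : ℝ)) * ∑ j, Real.exp (estimator θT (extractor θE (D.xt j))))

/-- The objective of the minimax problem. -/
def loss (D : Data dx K ns nt) (θE : ExtractorParam dx dz) (θC : ClassifierParam dz K)
    (θT : EstimatorParam dz) : ℝ :=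
  D.μ * sourceLoss D θE θC + (1 - D.μ) * targetLoss D θE θC + D.lam * zeta D θT θE

/-- The objective as a function on the joint Euclidean space. -/
def jointLoss (D : Data dx K ns nt) (u : JointVar dx dz K) : ℝ :=
  loss D u.fst.fst u.fst.snd u.snd

end Loss

/-- `F` is differentiable on `S` with a `ν`-Lipschitz gradient on `S`. -/
def IsSmoothOn {V : Type*} [NormedAddCommGroup V] [InnerProductSpace ℝ V] [CompleteSpace V]
    (F : V → ℝ) (ν : ℝ) (S : Set V) : Prop :=
  (∀ u ∈ S, DifferentiableAt ℝ F u) ∧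
    ∀ u ∈ S, ∀ v ∈ S, ‖gradient F u - gradient F v‖ ≤ ν * ‖u - v‖

/-- A nearest point of `S` to `p`; it exists and is unique for `S` nonempty, closed, convex in
a finite-dimensional Euclidean space, and it is `p` itself if `p ∈ S`. -/
def proj {V : Type*} [NormedAddCommGroup V] (S : Set V) (p : V) : V :=
  Classical.epsilon fun q => q ∈ S ∧ ∀ w ∈ S, ‖p - q‖ ≤ ‖p - w‖

/-- The convex compact sets to which the parameters are confined. -/
structure ParamSets (dx dz K : ℕ) where
  E : Set (ExtractorParam dx dz)
  C : Set (ClassifierParam dz K)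
  T : Set (EstimatorParam dz)
  convex_E : Convex ℝ E
  convex_C : Convex ℝ C
  convex_T : Convex ℝ T
  compact_E : IsCompact E
  compact_C : IsCompact C
  compact_T : IsCompact T
  nonempty_E : E.Nonempty
  nonempty_C : C.Nonempty
  nonempty_T : T.Nonempty

/-- The feasible set of `(θ_E, θ_C)`. -/
def ParamSets.minSet {dx dz K : ℕ} (S : ParamSets dx dz K) : Set (MinVar dx dz K) :=
  {x | x.fst ∈ S.E ∧ x.snd ∈ S.C}

/-- The feasible set of `((θ_E, θ_C), θ_T)`. -/
def ParamSets.jointSet {dx dz K : ℕ} (S : ParamSets dx dz K) : Set (JointVar dx dz K) :=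
  {u | u.fst ∈ S.minSet ∧ u.snd ∈ S.T}

/-- A state of the training algorithm: the current network parameters. -/
structure Params (dx dz K : ℕ) where
  E : ExtractorParam dx dz
  C : ClassifierParam dz K
  T : EstimatorParam dz

/-- The point `(θ_E, θ_C)` of a state. -/
def Params.minVar {dx dz K : ℕ} (p : Params dx dz K) : MinVar dx dz K :=
  WithLp.toLp 2 (p.E, p.C)

section Algorithm

variable {dx dz K ns nt : ℕ}

/-- One (projected) gradient ascent step on the estimate network. -/
def ascentStep (D : Data dx K ns nt) (S : ParamSets dx dz K) (ηT : ℝ)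
    (θE : ExtractorParam dx dz) (θT : EstimatorParam dz) : EstimatorParam dz :=
  proj S.T (θT + ηT • gradient (fun τ => zeta D τ θE) θT)

/-- One pass of gradient ascent-descent training: `m` ascent steps on `θ_T`, then one descent
step on `θ_E` and `θ_C`, both computed from the loss at the new `θ_T`. -/
def gadStep (D : Data dx K ns nt) (S : ParamSets dx dz K) (m : ℕ) (ηT ηE ηC : ℝ)
    (p : Params dx dz K) : Params dx dz K :=
  let τ := (ascentStep D S ηT p.E)^[m] p.T
  { E := proj S.E (p.E - ηE • gradient (fun e => loss D e p.C τ) p.E)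
    C := proj S.C (p.C - ηC • gradient (fun c => loss D p.E c τ) p.C)
    T := τ }

/-- The state after `t` passes, started at `p`. -/
def gadIter (D : Data dx K ns nt) (S : ParamSets dx dz K) (m : ℕ) (ηT ηE ηC : ℝ)
    (p : Params dx dz K) (t : ℕ) : Params dx dz K :=
  (gadStep D S m ηT ηE ηC)^[t] p

/-- The primal function `Φ(θ_E, θ_C) = max over θ_T of the loss`. -/
def primal (D : Data dx K ns nt) (S : ParamSets dx dz K) (x : MinVar dx dz K) : ℝ :=
  ⨆ τ : S.T, loss D x.fst x.snd τ

/-- The Moreau envelope with parameter `1 / (2 ν)` of the primal function restricted to the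
feasible set of `(θ_E, θ_C)` (that is, set to `+∞` outside it). -/
def moreau (D : Data dx K ns nt) (S : ParamSets dx dz K) (ν : ℝ) (x : MinVar dx dz K) : ℝ :=
  ⨅ w : S.minSet, (primal D S w + ν * ‖(w : MinVar dx dz K) - x‖ ^ 2)

/-- `x` is an `ε`-stationary point of the minimax problem, in the sense customary for
nonconvex-concave problems with a `ν`-smooth objective. -/
def IsStationary (D : Data dx K ns nt) (S : ParamSets dx dz K) (ν ε : ℝ)
    (x : MinVar dx dz K) : Prop :=
  x ∈ S.minSet ∧ DifferentiableAt ℝ (moreau D S ν) x ∧ ‖gradient (moreau D S ν) x‖ ≤ ε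

end Algorithm

end GAD

end

namespace GAD

open Filter Topology

/-! ### Euclidean projection onto compact convex sets. -/

section Projection

variable {V : Type*} [NormedAddCommGroup V] [InnerProductSpace ℝ V]

/-! For fixed `θ_T` the loss is `ν`-smooth in `x = (θ_E, θ_C)`, so its maximum `Φ` over `θ_T` is
`ν`-weakly convex (`strongConvexOn_primal`) and its Moreau envelope is differentiable everywhere,
with gradient `2ν(x - p)` for the proximal point `p` (`exists_hasGradientAt_envelope`). The gradient
used in a descent step is a subgradient of `Φ` at `x_t` up to the weak convexity term and the inner
error `δ_t = Φ(x_t) - L(x_t, τ_{t+1})`, where `τ_t` is the `θ_T` of pass `t`. Hence each pass lowers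
the envelope by `η/2 ‖∇Φ_{1/2ν}(x_t)‖²`, up to `2νη δ_t + νη²G²`, where `G` bounds the gradient of
the loss (`envelope_descent`). The envelope has bounded oscillation, so it remains to make the `δ_t`
small on average.

The functional `ζ` is concave in `θ_T` (linear minus log-mean-exp) but not strongly concave, so one
pass need not shrink the error by a fixed factor. For a fixed competitor `z`, however, `m` ascent
steps bound the gap to `z` by `c(‖z - τ_t‖² - ‖z - τ_{t+1}‖²)`, which telescopes (`ascent_gap`). On
a block of `B` passes take for `z` a maximizer at the start of the block. Since `x` moves by at most
`ηG` per pass, `z` remains nearly optimal, and the errors of the block sum to at most `2B²ηG² +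
cR²`, with `R` the diameter of `T`. The mean error is then about `2BηG² + cR²/B`: choose `B` large,
then `η` small, then `N` large (`exists_stepsize`). All constants come from compactness, so `N`
serves every starting point. -/

theorem proj_spec {V : Type*} [NormedAddCommGroup V] {S : Set V} (hne : S.Nonempty)
    (hc : IsCompact S) (p : V) :
    proj S p ∈ S ∧ ∀ w ∈ S, ‖p - proj S p‖ ≤ ‖p - w‖ := by
  have h : ∃ q, q ∈ S ∧ ∀ w ∈ S, ‖p - q‖ ≤ ‖p - w‖ := by
    obtain ⟨q, hq, hmin⟩ := hc.exists_isMinOn hne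
      (f := fun w => ‖p - w‖) (by fun_prop)
    exact ⟨q, hq, fun w hw => hmin hw⟩
  exact Classical.epsilon_spec h

theorem proj_mem {V : Type*} [NormedAddCommGroup V] {S : Set V} (hne : S.Nonempty)
    (hc : IsCompact S) (p : V) : proj S p ∈ S :=
  (proj_spec hne hc p).1

/-- The obtuse angle property of the projection onto a convex set. -/
theorem inner_sub_proj_nonpos {S : Set V} (hne : S.Nonempty) (hc : IsCompact S)
    (hconv : Convex ℝ S) (p : V) {w : V} (hw : w ∈ S) :
    inner ℝ (p - proj S p) (w - proj S p) ≤ 0 := by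
  obtain ⟨hq, hmin⟩ := proj_spec hne hc p
  have : Nonempty S := ⟨⟨w, hw⟩⟩
  refine (norm_eq_iInf_iff_real_inner_le_zero hconv hq).1 ?_ w hw
  refine le_antisymm (le_ciInf fun v => hmin v v.2) ?_
  exact ciInf_le (f := fun v : S => ‖p - v‖) ⟨0, by rintro _ ⟨v, rfl⟩; positivity⟩ ⟨_, hq⟩

theorem norm_sub_proj_le {S : Set V} (hne : S.Nonempty) (hc : IsCompact S)
    (hconv : Convex ℝ S) (p : V) {w : V} (hw : w ∈ S) :
    ‖w - proj S p‖ ≤ ‖w - p‖ := by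
  have h := inner_sub_proj_nonpos hne hc hconv p hw
  have e : w - p = (w - proj S p) - (p - proj S p) := by abel
  have h2 := norm_sub_sq_real (w - proj S p) (p - proj S p)
  rw [← e, real_inner_comm] at h2
  refine le_of_sq_le_sq ?_ (norm_nonneg _)
  nlinarith [sq_nonneg ‖p - proj S p‖]

end Projection

/-! ### Quadratic bounds and projected gradient ascent for smooth functions. -/

section Smooth

variable {V : Type*} [NormedAddCommGroup V] [InnerProductSpace ℝ V] [CompleteSpace V]

/-- The quadratic upper bound for a function with a Lipschitz gradient on a convex set. -/
theorem IsSmoothOn.le_quadratic {F : V → ℝ} {ν : ℝ} {S : Set V} (h : IsSmoothOn F ν S)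
    (hS : Convex ℝ S) {u v : V} (hu : u ∈ S) (hv : v ∈ S) :
    F v ≤ F u + inner ℝ (gradient F u) (v - u) + ν / 2 * ‖v - u‖ ^ 2 := by
  set d := v - u with hd
  have hmem : ∀ s ∈ Set.Icc (0 : ℝ) 1, u + s • d ∈ S := fun s hs =>
    hS.add_smul_sub_mem hu hv hs
  -- The derivative is nonpositive by Cauchy–Schwarz and the Lipschitz bound along the segment;
  -- comparing `s = 0` with `s = 1` gives the claim.
  have hder : ∀ s ∈ Set.Icc (0 : ℝ) 1, HasDerivAt
      (fun s : ℝ => F (u + s • d) - s * inner ℝ (gradient F u) d - ν / 2 * ‖d‖ ^ 2 * s ^ 2)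
      (inner ℝ (gradient F (u + s • d)) d - inner ℝ (gradient F u) d - ν * ‖d‖ ^ 2 * s) s := by
    intro s hs
    have h1 : HasDerivAt (fun s : ℝ => u + s • d) d s := by
      simpa using ((hasDerivAt_id s).smul_const d).const_add u
    have h2 := (h.1 _ (hmem s hs)).hasGradientAt.hasFDerivAt.comp_hasDerivAt s h1
    have h3 := (hasDerivAt_id s).mul_const (inner ℝ (gradient F u) d)
    have h4 := ((hasDerivAt_id s).pow 2).const_mul (ν / 2 * ‖d‖ ^ 2)
    have h5 := (h2.sub h3).sub h4
    refine h5.congr_deriv ?_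
    simp
    ring
  have hanti : AntitoneOn
      (fun s : ℝ => F (u + s • d) - s * inner ℝ (gradient F u) d - ν / 2 * ‖d‖ ^ 2 * s ^ 2)
      (Set.Icc 0 1) := by
    refine antitoneOn_of_deriv_nonpos (convex_Icc 0 1)
      (fun s hs => (hder s hs).continuousAt.continuousWithinAt)
      (fun s hs => (hder s (interior_subset hs)).differentiableAt.differentiableWithinAt) ?_
    intro s hs
    have hs' := interior_subset hs
    rw [(hder s hs').deriv]
    have hlip := h.2 _ (hmem s hs') u hu
    rw [add_sub_cancel_left, norm_smul, Real.norm_of_nonneg hs'.1] at hlip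
    have hcs := real_inner_le_norm (gradient F (u + s • d) - gradient F u) d
    rw [inner_sub_left] at hcs
    nlinarith [mul_le_mul_of_nonneg_right hlip (norm_nonneg d)]
  have := hanti (Set.left_mem_Icc.2 zero_le_one) (Set.right_mem_Icc.2 zero_le_one) zero_le_one
  have e : u + d = v := by rw [hd]; abel
  simp only [one_smul, e, one_mul, one_pow, mul_one, zero_smul, add_zero, zero_mul, ne_eq,
    OfNat.ofNat_ne_zero, not_false_eq_true, zero_pow, mul_zero, sub_zero] at this
  linarith

theorem gradient_neg_of_differentiableAt {F : V → ℝ} {u : V} (h : DifferentiableAt ℝ F u) :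
    gradient (fun u => - F u) u = - gradient F u := by
  refine HasGradientAt.gradient (hasGradientAt_iff_hasFDerivAt.2 ?_)
  rw [map_neg]
  exact h.hasGradientAt.hasFDerivAt.neg

theorem IsSmoothOn.neg {F : V → ℝ} {ν : ℝ} {S : Set V} (h : IsSmoothOn F ν S) :
    IsSmoothOn (fun u => - F u) ν S := by
  refine ⟨fun u hu => (h.1 u hu).neg, fun u hu v hv => ?_⟩
  rw [gradient_neg_of_differentiableAt (h.1 u hu), gradient_neg_of_differentiableAt (h.1 v hv),
    neg_sub_neg, norm_sub_rev]
  exact h.2 u hu v hv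

/-- The quadratic lower bound for a function with a Lipschitz gradient on a convex set. -/
theorem IsSmoothOn.quadratic_le {F : V → ℝ} {ν : ℝ} {S : Set V} (h : IsSmoothOn F ν S)
    (hS : Convex ℝ S) {u v : V} (hu : u ∈ S) (hv : v ∈ S) :
    F u + inner ℝ (gradient F u) (v - u) - ν / 2 * ‖v - u‖ ^ 2 ≤ F v := by
  have h1 := h.neg.le_quadratic hS hu hv
  rw [gradient_neg_of_differentiableAt (h.1 u hu), inner_neg_left] at h1
  linarith

/-- One projected gradient ascent step on a smooth concave function. -/
theorem ascent_le {q : V → ℝ} {L η : ℝ} {S : Set V} (hL : IsSmoothOn q L S)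
    (hconv : Convex ℝ S) (hne : S.Nonempty) (hc : IsCompact S) (hη : 0 < η) (hηL : η * L ≤ 1)
    {y z : V} (hy : y ∈ S) (hz : z ∈ S)
    (hsup : q z ≤ q y + inner ℝ (gradient q y) (z - y)) :
    2 * η * (q z - q (proj S (y + η • gradient q y))) ≤
      ‖z - y‖ ^ 2 - ‖z - proj S (y + η • gradient q y)‖ ^ 2 := by
  set w := proj S (y + η • gradient q y) with hw
  have hwS : w ∈ S := proj_mem hne hc _
  have h1 := hL.quadratic_le hconv hy hwS
  have h2 := inner_sub_proj_nonpos hne hc hconv (y + η • gradient q y) hz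
  rw [← hw] at h2
  have e1 : y + η • gradient q y - w = η • gradient q y - (w - y) := by abel
  have e2 : z - w = (z - y) - (w - y) := by abel
  have h3 := norm_sub_sq_real (z - y) (w - y)
  rw [e2]
  rw [e1, e2] at h2
  simp only [inner_sub_left (η • gradient q y), inner_sub_right _ (z - y) (w - y),
    real_inner_smul_left, real_inner_self_eq_norm_sq] at h2
  rw [real_inner_comm (z - y) (w - y)] at h2
  -- The tangent at `y` bounds `q z`, smoothness bounds `q w` from below, and the obtuse angle links
  -- the two; `η * L ≤ 1` absorbs the leftover `‖w - y‖²`.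
  nlinarith [mul_le_mul_of_nonneg_left hsup hη.le, mul_le_mul_of_nonneg_left h1 hη.le,
    mul_le_mul_of_nonneg_right hηL (sq_nonneg ‖w - y‖)]

/-- Several projected gradient ascent steps on a smooth concave function. -/
theorem iterate_ascent_le {q : V → ℝ} {L η : ℝ} {S : Set V} (hL : IsSmoothOn q L S)
    (hconv : Convex ℝ S) (hne : S.Nonempty) (hc : IsCompact S) (hη : 0 < η) (hηL : η * L ≤ 1)
    (hsup : ∀ y z, q z ≤ q y + inner ℝ (gradient q y) (z - y))
    {y z : V} (hy : y ∈ S) (hz : z ∈ S) (m : ℕ) :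
    (fun y => proj S (y + η • gradient q y))^[m] y ∈ S ∧
    m * (2 * η * (q z - q ((fun y => proj S (y + η • gradient q y))^[m] y))) ≤
      ‖z - y‖ ^ 2 - ‖z - (fun y => proj S (y + η • gradient q y))^[m] y‖ ^ 2 := by
  induction m with
  | zero => simpa using hy
  | succ m ih =>
    rw [Function.iterate_succ_apply']
    set v := (fun y => proj S (y + η • gradient q y))^[m] y
    obtain ⟨hv, ih⟩ := ih
    refine ⟨proj_mem hne hc _, ?_⟩
    have h1 := ascent_le hL hconv hne hc hη hηL hv hz (hsup _ _)
    -- With `z = v` the same inequality says that a step never decreases `q`, so the last gap is at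
    -- most each earlier one and `m` times it is at most their sum.
    have h2 := ascent_le hL hconv hne hc hη hηL hv hv (hsup _ _)
    set w := proj S (v + η • gradient q v)
    have h3 : 0 ≤ η * (q w - q v) := by
      simp at h2
      nlinarith [sq_nonneg ‖v - w‖]
    push_cast
    nlinarith [mul_nonneg (Nat.cast_nonneg (α := ℝ) m) h3]

end Smooth

/-! ### The Moreau envelope of a weakly convex function. -/

section Envelope

variable {V : Type*} [NormedAddCommGroup V] [InnerProductSpace ℝ V]

/-- Quadratic growth at a proximal point of a weakly convex function. -/
theorem growth_of_isMinOn {A : Set V} {φ : V → ℝ} {ν : ℝ} (hφ : StrongConvexOn A (-ν) φ)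
    {x p : V} (hp : p ∈ A) (hmin : ∀ w ∈ A, φ p + ν * ‖p - x‖ ^ 2 ≤ φ w + ν * ‖w - x‖ ^ 2)
    {w : V} (hw : w ∈ A) :
    φ p + ν * ‖p - x‖ ^ 2 + ν / 2 * ‖w - p‖ ^ 2 ≤ φ w + ν * ‖w - x‖ ^ 2 := by
  -- The quadratic has modulus `2ν`, against `-ν` for `φ`, so the sum is `ν`-strongly convex.
  -- Minimality of `p` is tested on the segment towards `w`, divided by `s`, and then `s → 0`.
  have key : ∀ s ∈ Set.Ioo (0 : ℝ) 1,
      φ p + ν * ‖p - x‖ ^ 2 + ν / 2 * ‖w - p‖ ^ 2 * (1 - s) ≤ φ w + ν * ‖w - x‖ ^ 2 := by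
    rintro s ⟨hs0, hs1⟩
    have hs1' : 0 ≤ 1 - s := by linarith
    have hmem : s • w + (1 - s) • p ∈ A := hφ.1 hw hp hs0.le hs1' (by ring)
    have h1 := hφ.2 hw hp hs0.le hs1' (by ring)
    have h2 := hmin _ hmem
    have h3 : ‖s • w + (1 - s) • p - x‖ ^ 2 =
        s * ‖w - x‖ ^ 2 + (1 - s) * ‖p - x‖ ^ 2 - s * (1 - s) * ‖w - p‖ ^ 2 := by
      have e1 : s • w + (1 - s) • p - x = s • (w - x) + (1 - s) • (p - x) := by module
      have e2 : w - p = (w - x) - (p - x) := by abel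
      rw [e1, e2, norm_add_sq_real, norm_sub_sq_real (w - x) (p - x), norm_smul, norm_smul,
        real_inner_smul_left, real_inner_smul_right, Real.norm_of_nonneg hs0.le,
        Real.norm_of_nonneg hs1']
      ring
    simp only [smul_eq_mul] at h1
    rw [h3] at h2
    have h4 : 0 ≤ s * (φ w + ν * ‖w - x‖ ^ 2 -
        (φ p + ν * ‖p - x‖ ^ 2 + ν / 2 * ‖w - p‖ ^ 2 * (1 - s))) := by linarith
    have := nonneg_of_mul_nonneg_right h4 hs0
    linarith
  have hcont : Tendsto (fun s : ℝ => φ p + ν * ‖p - x‖ ^ 2 + ν / 2 * ‖w - p‖ ^ 2 * (1 - s))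
      (𝓝[>] 0) (𝓝 (φ p + ν * ‖p - x‖ ^ 2 + ν / 2 * ‖w - p‖ ^ 2 * (1 - 0))) :=
    (Continuous.tendsto (by fun_prop) 0).mono_left nhdsWithin_le_nhds
  have := le_of_tendsto hcont (by
    filter_upwards [Ioo_mem_nhdsGT (zero_lt_one (α := ℝ))] with s hs using key s hs)
  simpa using this

/-- The Moreau envelope of the restriction of `φ` to `A`. -/
noncomputable def envelope {V : Type*} [NormedAddCommGroup V] (A : Set V) (φ : V → ℝ) (ν : ℝ) (x : V) : ℝ :=
  ⨅ w : A, (φ w + ν * ‖(w : V) - x‖ ^ 2)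

theorem envelope_le {V : Type*} [NormedAddCommGroup V] {A : Set V} {φ : V → ℝ} {ν b : ℝ}
    (hν : 0 ≤ ν) (hb : ∀ w ∈ A, b ≤ φ w)
    (x : V) {w : V} (hw : w ∈ A) : envelope A φ ν x ≤ φ w + ν * ‖w - x‖ ^ 2 :=
  ciInf_le (f := fun w : A => φ w + ν * ‖(w : V) - x‖ ^ 2)
    ⟨b, by rintro _ ⟨v, rfl⟩; exact (hb v v.2).trans (le_add_of_nonneg_right (by positivity))⟩ ⟨w, hw⟩

theorem le_envelope {V : Type*} [NormedAddCommGroup V] {A : Set V} {φ : V → ℝ} {ν b : ℝ}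
    (hne : A.Nonempty) {x : V}
    (h : ∀ w ∈ A, b ≤ φ w + ν * ‖w - x‖ ^ 2) : b ≤ envelope A φ ν x :=
  have := hne.to_subtype
  le_ciInf fun w => h w w.2

/-- The Moreau envelope of a weakly convex function is differentiable. -/
theorem exists_hasGradientAt_envelope [CompleteSpace V] {A : Set V} {φ : V → ℝ} {ν : ℝ}
    (hν : 0 ≤ ν) (hA : IsCompact A) (hne : A.Nonempty) (hφ : StrongConvexOn A (-ν) φ)
    (hcont : ContinuousOn φ A) (x : V) :
    ∃ p ∈ A, envelope A φ ν x = φ p + ν * ‖p - x‖ ^ 2 ∧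
      (∀ w ∈ A, φ p + ν * ‖p - x‖ ^ 2 + ν / 2 * ‖w - p‖ ^ 2 ≤ φ w + ν * ‖w - x‖ ^ 2) ∧
      HasGradientAt (envelope A φ ν) ((2 * ν) • (x - p)) x := by
  obtain ⟨b, hb⟩ := (hA.image_of_continuousOn hcont).bddBelow
  replace hb : ∀ w ∈ A, b ≤ φ w := fun w hw => hb ⟨w, hw, rfl⟩
  obtain ⟨p, hp, hmin⟩ := hA.exists_isMinOn hne
    (f := fun w => φ w + ν * ‖w - x‖ ^ 2) (by fun_prop)
  have hgrow := fun w (hw : w ∈ A) => growth_of_isMinOn hφ hp (fun w hw => hmin hw) hw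
  have hval : envelope A φ ν x = φ p + ν * ‖p - x‖ ^ 2 :=
    le_antisymm (envelope_le hν hb x hp) (le_envelope hne fun w hw => hmin hw)
  refine ⟨p, hp, hval, hgrow, ?_⟩
  -- A quadratic error bound for the linearization. Above, `p` is a competitor at `x'`; below, the
  -- growth term `ν/2 ‖w - p‖²` compensates for the change of minimizer by completing a square.
  have hbound : ∀ x', ‖envelope A φ ν x' - envelope A φ ν x -
      inner ℝ ((2 * ν) • (x - p)) (x' - x)‖ ≤ ν * ‖x' - x‖ ^ 2 := by
    intro x'
    have hexp : ∀ w : V, ‖w - x'‖ ^ 2 =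
        ‖w - x‖ ^ 2 + 2 * inner ℝ (x - w) (x' - x) + ‖x' - x‖ ^ 2 := by
      intro w
      have e : w - x' = -((x - w) + (x' - x)) := by abel
      rw [e, norm_neg, norm_add_sq_real, norm_sub_rev w x]
    rw [real_inner_smul_left, Real.norm_eq_abs, abs_le]
    constructor
    · have : envelope A φ ν x + 2 * ν * inner ℝ (x - p) (x' - x) - ν * ‖x' - x‖ ^ 2 ≤
          envelope A φ ν x' := by
        refine le_envelope hne fun w hw => ?_
        have h1 := hgrow w hw
        have h2 := real_inner_le_norm (w - p) (x' - x)
        have e : x - w = (x - p) - (w - p) := by abel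
        rw [hexp w, e, inner_sub_left (x - p), hval]
        nlinarith [mul_nonneg hν (sq_nonneg (‖w - p‖ - 2 * ‖x' - x‖)),
          mul_le_mul_of_nonneg_left h2 hν]
      linarith
    · have := envelope_le hν hb x' hp
      rw [hexp p] at this
      linarith
  rw [hasGradientAt_iff_isLittleO]
  refine Asymptotics.IsBigO.trans_isLittleO (g := fun x' => ‖x' - x‖ ^ 2)
    (Asymptotics.IsBigO.of_bound ν (Eventually.of_forall fun x' => ?_)) ?_
  · simpa using hbound x'
  · have := Asymptotics.isLittleO_norm_pow_id (E' := V) one_lt_two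
    have h2 : Tendsto (fun x' => x' - x) (𝓝 x) (𝓝 0) := by
      simpa using (continuous_sub_right x).tendsto x
    simpa [Function.comp_def] using this.comp_tendsto h2

/-- Descent of the Moreau envelope along an inexact projected subgradient step: `g` is a
subgradient of `φ` at `x` up to the error `δ` and the weak convexity term. -/
theorem envelope_descent [CompleteSpace V] {A : Set V} {φ : V → ℝ} {ν η δ G : ℝ}
    (hν : 0 < ν) (hη : 0 ≤ η) (hA : IsCompact A) (hφ : StrongConvexOn A (-ν) φ)
    (hcont : ContinuousOn φ A) {x x' g : V} (hx : x ∈ A) (hg : ‖g‖ ≤ G)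
    (hsub : ∀ w ∈ A, φ x - δ + inner ℝ g (w - x) - ν / 2 * ‖w - x‖ ^ 2 ≤ φ w)
    (hx' : ∀ w ∈ A, ‖w - x'‖ ≤ ‖w - (x - η • g)‖) :
    envelope A φ ν x' ≤ envelope A φ ν x + 2 * ν * η * δ -
      η / 2 * ‖gradient (envelope A φ ν) x‖ ^ 2 + ν * η ^ 2 * G ^ 2 := by
  obtain ⟨b, hb⟩ := (hA.image_of_continuousOn hcont).bddBelow
  replace hb : ∀ w ∈ A, b ≤ φ w := fun w hw => hb ⟨w, hw, rfl⟩
  obtain ⟨p, hp, hval, hgrow, hgrad⟩ :=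
    exists_hasGradientAt_envelope hν.le hA ⟨x, hx⟩ hφ hcont x
  have h1 := envelope_le hν.le hb x' hp
  have h2 : ‖p - x'‖ ^ 2 ≤ ‖p - (x - η • g)‖ ^ 2 := by gcongr; exact hx' p hp
  have h3 : ‖p - (x - η • g)‖ ^ 2 = ‖p - x‖ ^ 2 + 2 * η * inner ℝ g (p - x) + η ^ 2 * ‖g‖ ^ 2 := by
    have e : p - (x - η • g) = (p - x) + η • g := by abel
    rw [e, norm_add_sq_real, real_inner_smul_right, norm_smul, real_inner_comm, mul_pow,
      Real.norm_eq_abs, sq_abs]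
    ring
  have h4 := hsub p hp
  have h5 := hgrow x hx
  rw [sub_self, norm_zero] at h5
  have h6 : ‖g‖ ^ 2 ≤ G ^ 2 := by gcongr
  rw [hgrad.gradient, hval, norm_smul, mul_pow, Real.norm_eq_abs, sq_abs, norm_sub_rev x p]
  rw [norm_sub_rev x p] at h5
  -- Growth at `p` gives `φ x - φ p ≥ 3ν/2 ‖p - x‖²`; the inexact subgradient inequality loses only
  -- `ν/2` of it. As the gradient of the envelope has norm `2ν ‖p - x‖`, this is the source of the
  -- decrease.
  have h7 : inner ℝ g (p - x) ≤ δ - ν * ‖p - x‖ ^ 2 := by linarith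
  nlinarith [mul_le_mul_of_nonneg_left h7 (mul_nonneg hν.le hη),
    mul_le_mul_of_nonneg_left h6 (mul_nonneg hν.le (sq_nonneg η)),
    mul_le_mul_of_nonneg_left h2 hν.le]

end Envelope

/-! ### Averaging the descent recursion over blocks. -/

section Averages

/-- Since the terms are nonnegative, the last incomplete block may be filled up; this is the `+ 1`.
-/
theorem sum_le_of_block_sum_le {δ : ℕ → ℝ} {B : ℕ} {c : ℝ} (hB : 0 < B) (hδ : ∀ t, 0 ≤ δ t)
    (h : ∀ s, ∑ t ∈ Finset.range B, δ (s + t) ≤ c) (n : ℕ) :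
    ∑ t ∈ Finset.range n, δ t ≤ (n / B + 1) * c := by
  have hc : 0 ≤ c := (Finset.sum_nonneg fun t _ => hδ _).trans (h 0)
  have hq : ∀ q : ℕ, ∑ t ∈ Finset.range (q * B), δ t ≤ q * c := by
    intro q
    induction q with
    | zero => simp
    | succ q ih =>
      rw [add_mul, one_mul, Finset.sum_range_add]
      push_cast
      linarith [h (q * B)]
  have hn : n ≤ (n / B + 1) * B := by
    have := Nat.lt_div_mul_add hB (a := n)
    rw [add_mul, one_mul]
    exact this.le
  calc ∑ t ∈ Finset.range n, δ t ≤ ∑ t ∈ Finset.range ((n / B + 1) * B), δ t :=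
        Finset.sum_le_sum_of_subset_of_nonneg (Finset.range_mono hn) fun t _ _ => hδ t
    _ ≤ ((n / B + 1 : ℕ) : ℝ) * c := hq _
    _ ≤ _ := by
        push_cast
        gcongr
        exact Nat.cast_div_le

/-- Step sizes for which a descent recursion with errors that are small on average over blocks
makes the averages of `g` small, uniformly over all the sequences. -/
theorem exists_stepsize {ν G C Ω ε : ℝ} (hν : 0 ≤ ν) (hC : 0 ≤ C) (hΩ : 0 ≤ Ω)
    (hε : 0 < ε) :
    ∃ ηmax : ℝ, 0 < ηmax ∧ ∀ η : ℝ, 0 < η → η ≤ ηmax → ∃ N : ℕ, 0 < N ∧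
      ∀ M g δ : ℕ → ℝ,
        (∀ t, M (t + 1) ≤ M t + 2 * ν * η * δ t - η / 2 * g t + ν * η ^ 2 * G ^ 2) →
        (∀ t, M 0 - M t ≤ Ω) → (∀ t, 0 ≤ δ t) →
        (∀ s B : ℕ, ∑ t ∈ Finset.range B, δ (s + t) ≤ B * (B * (2 * η * G ^ 2)) + C) →
        ∀ n : ℕ, N ≤ n → (1 / (n : ℝ)) * ∑ t ∈ Finset.range n, g t ≤ ε := by
  -- The block length is fixed before `η`, so that the part `4νC/B` of the average is at most `ε/4`.
  obtain ⟨B, hB⟩ := exists_nat_gt (4 * ν * C * 4 / ε)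
  have hB0 : (0 : ℝ) < B := lt_of_le_of_lt (by positivity) hB
  rw [div_lt_iff₀ hε] at hB
  -- `κ` collects the terms linear in `η`: the drift within a block and the squared step. The terms
  -- in `W` do not grow with `n` and are beaten by `N`.
  set κ : ℝ := 8 * ν * G ^ 2 * B + 2 * ν * G ^ 2 with hκ
  have hκ0 : 0 ≤ κ := by positivity
  refine ⟨ε / (4 * (κ + 1)), by positivity, fun η hη hηm => ?_⟩
  set c : ℝ := B * (B * (2 * η * G ^ 2)) + C with hc
  have hc0 : 0 ≤ c := by positivity
  set W : ℝ := 2 * Ω / η + 4 * ν * c with hW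
  have hW0 : 0 ≤ W := by positivity
  obtain ⟨N, hN⟩ := exists_nat_gt (4 * W / ε)
  have hN0 : (0 : ℝ) < N := lt_of_le_of_lt (by positivity) hN
  refine ⟨N, by exact_mod_cast hN0, fun M g δ hM hMΩ hδ hblock n hn => ?_⟩
  have hn0 : (0 : ℝ) < n := lt_of_lt_of_le hN0 (by exact_mod_cast hn)
  have hWn : 4 * W ≤ n * ε := by
    rw [div_lt_iff₀ hε] at hN
    have : (N : ℝ) * ε ≤ n * ε := by gcongr
    linarith
  have hηκ : η * κ ≤ ε / 4 := by
    rw [le_div_iff₀ (by positivity)] at hηm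
    nlinarith
  have htel : ∀ n : ℕ, η / 2 * ∑ t ∈ Finset.range n, g t ≤
      M 0 - M n + 2 * ν * η * ∑ t ∈ Finset.range n, δ t + n * (ν * η ^ 2 * G ^ 2) := by
    intro n
    induction n with
    | zero => simp
    | succ n ih =>
      rw [Finset.sum_range_succ, Finset.sum_range_succ]
      push_cast
      linarith [hM n]
  have hsum := sum_le_of_block_sum_le (by exact_mod_cast hB0) hδ (fun s => hblock s B) n
  rw [← hc] at hsum
  have h1 : η / 2 * ∑ t ∈ Finset.range n, g t ≤
      Ω + 2 * ν * η * ((n / B + 1) * c) + n * (ν * η ^ 2 * G ^ 2) := by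
    have := mul_le_mul_of_nonneg_left hsum (by positivity : 0 ≤ 2 * ν * η)
    linarith [htel n, hMΩ n]
  have h2 : ∑ t ∈ Finset.range n, g t ≤
      W + n * (η * κ) + n * (4 * ν * C / B) := by
    refine le_of_mul_le_mul_left (h1.trans (le_of_eq ?_)) (by positivity : 0 < η / 2)
    rw [hW, hκ, hc]
    field_simp
    ring
  have h3 : 4 * ν * C / B ≤ ε / 4 := by
    rw [div_le_div_iff₀ hB0 (by norm_num)]
    linarith
  rw [one_div_mul_eq_div, div_le_iff₀ hn0]
  nlinarith [mul_le_mul_of_nonneg_left h3 hn0.le, mul_le_mul_of_nonneg_left hηκ hn0.le]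

end Averages

/-! ### Smoothness of the loss. -/

section Regularity

/-- A `C²` function has a Lipschitz gradient on every convex compact set. -/
theorem exists_isSmoothOn_of_contDiff {V : Type*} [NormedAddCommGroup V] [InnerProductSpace ℝ V]
    [CompleteSpace V] {F : V → ℝ} (hF : ContDiff ℝ 2 F) {S : Set V} (hS : Convex ℝ S)
    (hc : IsCompact S) : ∃ ν : ℝ, 0 < ν ∧ IsSmoothOn F ν S := by
  have h1 : ContDiff ℝ 1 (fderiv ℝ F) := hF.fderiv_right (by norm_num)
  have h2 : Continuous (fderiv ℝ (fderiv ℝ F)) := h1.continuous_fderiv (by norm_num)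
  obtain ⟨C, hC⟩ := hc.exists_bound_of_continuousOn (f := fderiv ℝ (fderiv ℝ F))
    h2.continuousOn
  refine ⟨max C 1, by positivity, fun u _ => hF.differentiable (by norm_num) u,
    fun u hu v hv => ?_⟩
  have h3 := hS.norm_image_sub_le_of_norm_fderiv_le (f := fderiv ℝ F)
    (fun x _ => h1.differentiable (by norm_num) x)
    (fun x hx => (hC x hx).trans (le_max_left C 1)) hv hu
  rw [gradient, gradient, ← map_sub, LinearIsometryEquiv.norm_map]
  exact h3

theorem exists_gradient_bound {V : Type*} [NormedAddCommGroup V] [InnerProductSpace ℝ V]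
    [CompleteSpace V] {F : V → ℝ} (hF : ContDiff ℝ 2 F) {S : Set V} (hS : Convex ℝ S)
    (hc : IsCompact S) : ∃ G : ℝ, 0 ≤ G ∧ (∀ u ∈ S, ‖gradient F u‖ ≤ G) ∧
      ∀ u ∈ S, ∀ v ∈ S, |F u - F v| ≤ G * ‖u - v‖ := by
  obtain ⟨C, hC⟩ := hc.exists_bound_of_continuousOn
    (hF.continuous_fderiv (by norm_num)).continuousOn
  refine ⟨max C 0, le_max_right _ _, fun u hu => ?_, fun u hu v hv => ?_⟩
  · rw [gradient, LinearIsometryEquiv.norm_map]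
    exact (hC u hu).trans (le_max_left _ _)
  · exact hS.norm_image_sub_le_of_norm_fderiv_le
      (fun x _ => hF.differentiable (by norm_num) x)
      (fun x hx => (hC x hx).trans (le_max_left _ _)) hv hu

theorem contDiff_withLp_fst {X Y : Type*} [NormedAddCommGroup X] [NormedSpace ℝ X]
    [NormedAddCommGroup Y] [NormedSpace ℝ Y] {n : WithTop ℕ∞} :
    ContDiff ℝ n fun u : WithLp 2 (X × Y) => u.fst :=
  contDiff_fst.comp (WithLp.prodContinuousLinearEquiv 2 ℝ X Y).contDiff

theorem contDiff_withLp_snd {X Y : Type*} [NormedAddCommGroup X] [NormedSpace ℝ X]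
    [NormedAddCommGroup Y] [NormedSpace ℝ Y] {n : WithTop ℕ∞} :
    ContDiff ℝ n fun u : WithLp 2 (X × Y) => u.snd :=
  contDiff_snd.comp (WithLp.prodContinuousLinearEquiv 2 ℝ X Y).contDiff

variable {dx dz K ns nt : ℕ}

theorem contDiff_crossEntropy_softmax {V : Type*} [NormedAddCommGroup V] [NormedSpace ℝ V]
    {n : WithTop ℕ∞} {v : V → Fin K → ℝ} (hv : ∀ k, ContDiff ℝ n fun u => v u k) (y : Fin K) :
    ContDiff ℝ n fun u => crossEntropy (softmax (v u)) y := by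
  -- The label `y` witnesses that `Fin K` is nonempty.
  have hpos : ∀ u, 0 < ∑ j, Real.exp (v u j) := fun u =>
    Finset.sum_pos (fun j _ => Real.exp_pos _) ⟨y, Finset.mem_univ y⟩
  unfold crossEntropy softmax
  refine (ContDiff.sum fun k _ => contDiff_const.mul (ContDiff.log ?_ fun u => ?_)).neg
  · exact (hv k).exp.div (ContDiff.sum fun j _ => (hv j).exp) fun u => (hpos u).ne'
  · exact (div_pos (Real.exp_pos _) (hpos u)).ne'

theorem mean_exp_pos (hnt : 0 < nt) (v : Fin nt → ℝ) :
    0 < (1 / (nt : ℝ)) * ∑ j, Real.exp (v j) := by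
  have : 0 < ∑ j, Real.exp (v j) :=
    Finset.sum_pos (fun j _ => Real.exp_pos _) ⟨⟨0, hnt⟩, Finset.mem_univ _⟩
  positivity

theorem contDiff_jointLoss (hnt : 0 < nt) (D : Data dx K ns nt) :
    ContDiff ℝ 2 (jointLoss (dz := dz) D) := by
  have hE : ∀ ij, ContDiff ℝ 2 fun u : JointVar dx dz K => u.fst.fst ij := by
    intro ij
    exact (EuclideanSpace.proj (𝕜 := ℝ) ij).contDiff.comp
      (contDiff_withLp_fst.comp contDiff_withLp_fst)
  have hC : ∀ ij, ContDiff ℝ 2 fun u : JointVar dx dz K => u.fst.snd ij := by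
    intro ij
    exact (EuclideanSpace.proj (𝕜 := ℝ) ij).contDiff.comp
      (contDiff_withLp_snd.comp contDiff_withLp_fst)
  have hT : ∀ i, ContDiff ℝ 2 fun u : JointVar dx dz K => u.snd i := by
    intro i
    exact (EuclideanSpace.proj (𝕜 := ℝ) i).contDiff.comp contDiff_withLp_snd
  have hz : ∀ (x : Fin dx → ℝ) i,
      ContDiff ℝ 2 fun u : JointVar dx dz K => extractor u.fst.fst x i := fun x i => by
    simp only [extractor, Matrix.mulVec, dotProduct, Matrix.of_apply]
    exact ContDiff.sum fun j _ => (hE _).mul contDiff_const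
  have hc : ∀ (x : Fin dx → ℝ) k, ContDiff ℝ 2 fun u : JointVar dx dz K =>
      classifier u.fst.snd (extractor u.fst.fst x) k := fun x k => by
    simp only [classifier, Matrix.mulVec, dotProduct, Matrix.of_apply]
    exact ContDiff.sum fun j _ => (hC _).mul (hz x j)
  have ht : ∀ x : Fin dx → ℝ, ContDiff ℝ 2 fun u : JointVar dx dz K =>
      estimator u.snd (extractor u.fst.fst x) := fun x =>
    ContDiff.sum fun j _ => (hT _).mul (hz x j)
  unfold jointLoss loss sourceLoss targetLoss zeta
  refine ((contDiff_const.mul (contDiff_const.mul (ContDiff.sum fun i _ => ?_))).add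
    (contDiff_const.mul (contDiff_const.mul (ContDiff.sum fun i _ => ?_)))).add
    (contDiff_const.mul ((contDiff_const.mul (ContDiff.sum fun i _ => ht _)).sub
    (ContDiff.log (contDiff_const.mul (ContDiff.sum fun i _ => (ht _).exp)) fun u => ?_)))
  · exact contDiff_const.mul (contDiff_crossEntropy_softmax (hc _) _)
  · exact contDiff_const.mul (contDiff_crossEntropy_softmax (hc _) _)
  · exact (mean_exp_pos hnt _).ne'

end Regularity

/-! ### Convexity and compactness of the feasible sets. -/

section FeasibleSets

variable {dx dz K : ℕ}

theorem convex_minSet (S : ParamSets dx dz K) : Convex ℝ S.minSet :=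
  fun _ hx _ hy _ _ ha hb hab =>
    ⟨S.convex_E hx.1 hy.1 ha hb hab, S.convex_C hx.2 hy.2 ha hb hab⟩

theorem convex_jointSet (S : ParamSets dx dz K) : Convex ℝ S.jointSet :=
  fun _ hx _ hy _ _ ha hb hab =>
    ⟨convex_minSet S hx.1 hy.1 ha hb hab, S.convex_T hx.2 hy.2 ha hb hab⟩

theorem isCompact_withLp_prod {X Y : Type*} [TopologicalSpace X] [TopologicalSpace Y]
    {A : Set X} {B : Set Y} (hA : IsCompact A) (hB : IsCompact B) :
    IsCompact {u : WithLp 2 (X × Y) | u.fst ∈ A ∧ u.snd ∈ B} := by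
  have h := (hA.prod hB).image (WithLp.prod_continuous_toLp 2 X Y)
  convert h using 1
  ext u
  constructor
  · exact fun hu => ⟨(u.fst, u.snd), hu, rfl⟩
  · rintro ⟨v, hv, rfl⟩
    exact hv

theorem isCompact_minSet (S : ParamSets dx dz K) : IsCompact S.minSet :=
  isCompact_withLp_prod S.compact_E S.compact_C

theorem isCompact_jointSet (S : ParamSets dx dz K) : IsCompact S.jointSet :=
  isCompact_withLp_prod (isCompact_minSet S) S.compact_T

end FeasibleSets

/-! ### Partial gradients as components of the joint gradient. -/

section PartialGradients

variable {X Y : Type*} [NormedAddCommGroup X] [InnerProductSpace ℝ X] [CompleteSpace X]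
  [NormedAddCommGroup Y] [InnerProductSpace ℝ Y] [CompleteSpace Y]

theorem hasGradientAt_partial_fst {F : WithLp 2 (X × Y) → ℝ} {g : WithLp 2 (X × Y)} {x : X}
    {y : Y} (h : HasGradientAt F g (WithLp.toLp 2 (x, y))) :
    HasGradientAt (fun x => F (WithLp.toLp 2 (x, y))) g.fst x := by
  rw [hasGradientAt_iff_isLittleO] at h ⊢
  have ht : Tendsto (fun x' : X => (WithLp.toLp 2 (x', y) : WithLp 2 (X × Y))) (𝓝 x)
      (𝓝 (WithLp.toLp 2 (x, y))) :=
    Continuous.tendsto (by fun_prop) x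
  have h2 := h.comp_tendsto ht
  have e : ∀ x' : X, (WithLp.toLp 2 (x', y) - WithLp.toLp 2 (x, y) : WithLp 2 (X × Y)) =
      WithLp.toLp 2 (x' - x, 0) := fun x' => by rw [← WithLp.toLp_sub]; simp
  simp only [Function.comp_def, e, WithLp.prod_inner_apply, inner_zero_right, add_zero] at h2
  refine h2.trans_isBigO (Asymptotics.IsBigO.of_bound 1 (Eventually.of_forall fun x' => ?_))
  simp

theorem hasGradientAt_partial_snd {F : WithLp 2 (X × Y) → ℝ} {g : WithLp 2 (X × Y)} {x : X}
    {y : Y} (h : HasGradientAt F g (WithLp.toLp 2 (x, y))) :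
    HasGradientAt (fun y => F (WithLp.toLp 2 (x, y))) g.snd y := by
  rw [hasGradientAt_iff_isLittleO] at h ⊢
  have ht : Tendsto (fun y' : Y => (WithLp.toLp 2 (x, y') : WithLp 2 (X × Y))) (𝓝 y)
      (𝓝 (WithLp.toLp 2 (x, y))) :=
    Continuous.tendsto (by fun_prop) y
  have h2 := h.comp_tendsto ht
  have e : ∀ y' : Y, (WithLp.toLp 2 (x, y') - WithLp.toLp 2 (x, y) : WithLp 2 (X × Y)) =
      WithLp.toLp 2 (0, y' - y) := fun y' => by rw [← WithLp.toLp_sub]; simp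
  simp only [Function.comp_def, e, WithLp.prod_inner_apply, inner_zero_right, zero_add] at h2
  refine h2.trans_isBigO (Asymptotics.IsBigO.of_bound 1 (Eventually.of_forall fun x' => ?_))
  simp

end PartialGradients

section WithLpNorm

variable {X Y : Type*} [SeminormedAddCommGroup X] [SeminormedAddCommGroup Y]

theorem norm_fst_le (u : WithLp 2 (X × Y)) : ‖u.fst‖ ≤ ‖u‖ := by
  refine le_of_sq_le_sq ?_ (norm_nonneg _)
  rw [WithLp.prod_norm_sq_eq_of_L2]
  linarith [sq_nonneg ‖u.snd‖]

theorem norm_snd_le (u : WithLp 2 (X × Y)) : ‖u.snd‖ ≤ ‖u‖ := by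
  refine le_of_sq_le_sq ?_ (norm_nonneg _)
  rw [WithLp.prod_norm_sq_eq_of_L2]
  linarith [sq_nonneg ‖u.fst‖]

end WithLpNorm

/-! ### Concavity of the Donsker-Varadhan functional in `θ_T`. -/

section Concavity

variable {dx dz K ns nt : ℕ}

/-- Convexity of log-sum-exp: the supporting affine function at `u`. -/
theorem log_mean_exp_support (hnt : 0 < nt) (u : Fin nt → ℝ) :
    ∃ p : Fin nt → ℝ, ∀ v : Fin nt → ℝ,
      Real.log ((1 / (nt : ℝ)) * ∑ j, Real.exp (u j)) + ∑ j, p j * (v j - u j) ≤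
        Real.log ((1 / (nt : ℝ)) * ∑ j, Real.exp (v j)) := by
  have hZ : 0 < ∑ j, Real.exp (u j) :=
    Finset.sum_pos (fun j _ => Real.exp_pos _) ⟨⟨0, hnt⟩, Finset.mem_univ _⟩
  set Z := ∑ j, Real.exp (u j) with hZdef
  refine ⟨fun j => Real.exp (u j) / Z, fun v => ?_⟩
  set c := ∑ j, Real.exp (u j) / Z * (v j - u j) with hc
  have h1 : ∑ j, Real.exp (u j) / Z = 1 := by
    rw [← Finset.sum_div, div_self hZ.ne']
  have h2 : Z * Real.exp c ≤ ∑ j, Real.exp (v j) := by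
    -- This is `1 + a ≤ exp a`, centred at the softmax mean `c` of `v - u`, so that the first-order
    -- terms cancel in the sum over `j`.
    have h3 : ∀ j, Real.exp c * (Real.exp (u j) * (1 + (v j - u j - c))) ≤ Real.exp (v j) := by
      intro j
      have h4 := Real.add_one_le_exp (v j - u j - c)
      have h5 : Real.exp (v j) = Real.exp c * (Real.exp (u j) * Real.exp (v j - u j - c)) := by
        rw [← Real.exp_add, ← Real.exp_add]; congr 1; ring
      rw [h5]
      gcongr
      linarith
    refine le_trans (le_of_eq ?_) (Finset.sum_le_sum fun j _ => h3 j)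
    rw [← Finset.mul_sum, mul_comm]
    congr 1
    have h6 : ∑ j, Real.exp (u j) * (v j - u j) = Z * c := by
      rw [hc, Finset.mul_sum]
      refine Finset.sum_congr rfl fun j _ => ?_
      field_simp
    calc Z = Z + Z * c - Z * c := by ring
      _ = ∑ j, (Real.exp (u j) + Real.exp (u j) * (v j - u j) - Real.exp (u j) * c) := by
        rw [Finset.sum_sub_distrib, Finset.sum_add_distrib, h6, ← Finset.sum_mul]
      _ = _ := Finset.sum_congr rfl fun j _ => by ring
  have h0 : (0 : ℝ) < 1 / nt := by positivity
  rw [← Real.log_exp c, ← Real.log_mul (by positivity) (by positivity)]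
  refine Real.log_le_log (by positivity) ?_
  rw [mul_assoc]
  gcongr

/-- A function that has a supporting linear functional from above lies below its tangent. -/
theorem le_tangent_of_support {V : Type*} [NormedAddCommGroup V] [InnerProductSpace ℝ V]
    [CompleteSpace V] {q : V → ℝ} {y : V} (hq : DifferentiableAt ℝ q y)
    (h : ∃ l : V →L[ℝ] ℝ, ∀ z, q z ≤ q y + l (z - y)) (z : V) :
    q z ≤ q y + inner ℝ (gradient q y) (z - y) := by
  obtain ⟨l, hl⟩ := h
  -- Subtracting `l` turns `y` into a maximum, which forces the derivative of `q` at `y` to be `l`.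
  have hmax : IsLocalMax (fun z => q z - l z) y := Eventually.of_forall fun z => by
    have := hl z
    rw [map_sub] at this
    linarith
  have h1 := hmax.hasFDerivAt_eq_zero (hq.hasFDerivAt.sub l.hasFDerivAt)
  have h2 : inner ℝ (gradient q y) (z - y) = l (z - y) := by
    rw [gradient, InnerProductSpace.toDual_symm_apply, sub_eq_zero.1 h1]
  rw [h2]
  exact hl z

theorem zeta_support (hnt : 0 < nt) (D : Data dx K ns nt) (e : ExtractorParam dx dz)
    (y : EstimatorParam dz) :
    ∃ l : EstimatorParam dz →L[ℝ] ℝ, ∀ z, zeta D z e ≤ zeta D y e + l (z - y) := by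
  obtain ⟨p, hp⟩ := log_mean_exp_support hnt fun j => estimator y (extractor e (D.xt j))
  let est (v : Fin dz → ℝ) : EstimatorParam dz →L[ℝ] ℝ := ∑ i, v i • EuclideanSpace.proj i
  have hest : ∀ v z, est v z = estimator z v := fun v z => by
    simp [est, estimator, mul_comm]
  refine ⟨(1 / (ns : ℝ)) • ∑ i, est (extractor e (D.xs i)) -
    ∑ j, p j • est (extractor e (D.xt j)), fun z => ?_⟩
  have h1 := hp fun j => estimator z (extractor e (D.xt j))
  unfold zeta
  simp only [sub_apply, smul_apply, _root_.sum_apply, map_sub, hest, smul_eq_mul, Finset.sum_sub_distrib, mul_sub]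
    at h1 ⊢
  linarith

end Concavity

variable {dx dz K ns nt : ℕ}

/-! ### The primal function: attainment, weak convexity, Lipschitz continuity. -/

section Primal

theorem continuous_loss_estimator (hnt : 0 < nt) (D : Data dx K ns nt) (x : MinVar dx dz K) :
    Continuous fun τ => loss D x.fst x.snd τ := by
  have h : Continuous fun τ : EstimatorParam dz => (WithLp.toLp 2 (x, τ) : JointVar dx dz K) := by
    fun_prop
  have h2 : Continuous (jointLoss (dz := dz) D) := (contDiff_jointLoss hnt D).continuous
  change Continuous (jointLoss D ∘ fun τ : EstimatorParam dz => WithLp.toLp 2 (x, τ))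
  exact h2.comp h

theorem loss_le_primal (hnt : 0 < nt) (D : Data dx K ns nt) (S : ParamSets dx dz K)
    (x : MinVar dx dz K) {τ : EstimatorParam dz} (hτ : τ ∈ S.T) :
    loss D x.fst x.snd τ ≤ primal D S x := by
  obtain ⟨b, hb⟩ := (S.compact_T.image (continuous_loss_estimator hnt D x)).bddAbove
  exact le_ciSup (f := fun τ : S.T => loss D x.fst x.snd τ)
    ⟨b, by rintro _ ⟨v, rfl⟩; exact hb ⟨v, v.2, rfl⟩⟩ ⟨τ, hτ⟩

theorem exists_primal_eq (hnt : 0 < nt) (D : Data dx K ns nt) (S : ParamSets dx dz K)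
    (x : MinVar dx dz K) : ∃ τ ∈ S.T, primal D S x = loss D x.fst x.snd τ := by
  obtain ⟨τ, hτ, hmax⟩ := S.compact_T.exists_isMaxOn S.nonempty_T
    (continuous_loss_estimator hnt D x).continuousOn
  have := S.nonempty_T.to_subtype
  exact ⟨τ, hτ, le_antisymm (ciSup_le fun v => hmax v.2) (loss_le_primal hnt D S x hτ)⟩

theorem toLp_sub_toLp_left (w x : MinVar dx dz K) (τ : EstimatorParam dz) :
    (WithLp.toLp 2 (w, τ) - WithLp.toLp 2 (x, τ) : JointVar dx dz K) =
      WithLp.toLp 2 (w - x, 0) := by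
  rw [← WithLp.toLp_sub]
  simp

theorem toLp_sub_toLp_right (x : MinVar dx dz K) (τ σ : EstimatorParam dz) :
    (WithLp.toLp 2 (x, τ) - WithLp.toLp 2 (x, σ) : JointVar dx dz K) =
      WithLp.toLp 2 (0, τ - σ) := by
  rw [← WithLp.toLp_sub]
  simp

/-- The gradient of the objective with respect to `(θ_E, θ_C)`. -/
noncomputable def minGradient (D : Data dx K ns nt) (x : MinVar dx dz K)
    (τ : EstimatorParam dz) : MinVar dx dz K :=
  (gradient (jointLoss D) (WithLp.toLp 2 (x, τ))).fst

theorem loss_subgradient {D : Data dx K ns nt} {S : ParamSets dx dz K} {ν : ℝ}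
    (hs : IsSmoothOn (jointLoss (dz := dz) D) ν S.jointSet) {x w : MinVar dx dz K}
    (hx : x ∈ S.minSet) (hw : w ∈ S.minSet) {τ : EstimatorParam dz} (hτ : τ ∈ S.T) :
    loss D x.fst x.snd τ + inner ℝ (minGradient D x τ) (w - x) - ν / 2 * ‖w - x‖ ^ 2 ≤
      loss D w.fst w.snd τ := by
  have h := hs.quadratic_le (convex_jointSet S) (u := WithLp.toLp 2 (x, τ))
    (v := WithLp.toLp 2 (w, τ)) ⟨hx, hτ⟩ ⟨hw, hτ⟩
  rw [toLp_sub_toLp_left, WithLp.prod_inner_apply, WithLp.prod_norm_sq_eq_of_L2] at h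
  simpa [jointLoss, minGradient] using h

theorem primal_subgradient (hnt : 0 < nt) {D : Data dx K ns nt} {S : ParamSets dx dz K} {ν : ℝ}
    (hs : IsSmoothOn (jointLoss (dz := dz) D) ν S.jointSet) {x w : MinVar dx dz K}
    (hx : x ∈ S.minSet) (hw : w ∈ S.minSet) {τ : EstimatorParam dz} (hτ : τ ∈ S.T) :
    loss D x.fst x.snd τ + inner ℝ (minGradient D x τ) (w - x) - ν / 2 * ‖w - x‖ ^ 2 ≤
      primal D S w :=
  (loss_subgradient hs hx hw hτ).trans (loss_le_primal hnt D S w hτ)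

/-- The primal function of a smooth objective is weakly convex. -/
theorem strongConvexOn_primal (hnt : 0 < nt) {D : Data dx K ns nt} {S : ParamSets dx dz K} {ν : ℝ}
    (hs : IsSmoothOn (jointLoss (dz := dz) D) ν S.jointSet) :
    StrongConvexOn S.minSet (-ν) (primal D S) := by
  refine ⟨convex_minSet S, fun w hw p hp a b ha hb hab => ?_⟩
  set q := a • w + b • p with hq
  have hqS : q ∈ S.minSet := convex_minSet S hw hp ha hb hab
  -- A maximizer at the intermediate point `q` gives a quadratic minorant of the primal function
  -- touching it at `q`; in the weighted average of its values at `w` and `p` the linear terms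
  -- cancel.
  obtain ⟨τ, hτ, he⟩ := exists_primal_eq hnt D S q
  have h1 := primal_subgradient hnt hs hqS hw hτ
  have h2 := primal_subgradient hnt hs hqS hp hτ
  have ha' : a = 1 - b := by linarith
  have e1 : w - q = b • (w - p) := by rw [hq, ha']; module
  have e2 : p - q = (-a) • (w - p) := by rw [hq, ha']; module
  rw [e1, norm_smul, real_inner_smul_right, mul_pow, Real.norm_eq_abs, sq_abs] at h1
  rw [e2, norm_smul, real_inner_smul_right, mul_pow, Real.norm_eq_abs, sq_abs] at h2
  have h3 := mul_le_mul_of_nonneg_left h1 ha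
  have h4 := mul_le_mul_of_nonneg_left h2 hb
  simp only [smul_eq_mul]
  rw [he]
  subst ha'
  nlinarith

theorem primal_sub_le (hnt : 0 < nt) {D : Data dx K ns nt} {S : ParamSets dx dz K} {G : ℝ}
    (hG : ∀ u ∈ S.jointSet, ∀ v ∈ S.jointSet,
      |jointLoss (dz := dz) D u - jointLoss D v| ≤ G * ‖u - v‖)
    {x w : MinVar dx dz K} (hx : x ∈ S.minSet) (hw : w ∈ S.minSet) :
    (∀ τ ∈ S.T, loss D x.fst x.snd τ - loss D w.fst w.snd τ ≤ G * ‖x - w‖) ∧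
      primal D S x - primal D S w ≤ G * ‖x - w‖ := by
  have h : ∀ τ ∈ S.T, loss D x.fst x.snd τ - loss D w.fst w.snd τ ≤ G * ‖x - w‖ := by
    intro τ hτ
    have h1 := hG (WithLp.toLp 2 (x, τ)) ⟨hx, hτ⟩ (WithLp.toLp 2 (w, τ)) ⟨hw, hτ⟩
    rw [toLp_sub_toLp_left] at h1
    have h2 : ‖(WithLp.toLp 2 (x - w, 0) : JointVar dx dz K)‖ = ‖x - w‖ := by simp
    rw [h2] at h1
    exact (le_abs_self _).trans h1
  refine ⟨h, ?_⟩
  obtain ⟨τ, hτ, he⟩ := exists_primal_eq hnt D S x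
  linarith [h τ hτ, loss_le_primal hnt D S w hτ]

theorem continuousOn_primal (hnt : 0 < nt) {D : Data dx K ns nt} {S : ParamSets dx dz K} {G : ℝ}
    (hG0 : 0 ≤ G) (hG : ∀ u ∈ S.jointSet, ∀ v ∈ S.jointSet,
      |jointLoss (dz := dz) D u - jointLoss D v| ≤ G * ‖u - v‖) :
    ContinuousOn (primal D S) S.minSet := by
  refine (LipschitzOnWith.of_le_add_mul ⟨G, hG0⟩ fun x hx w hw => ?_).continuousOn
  have := (primal_sub_le hnt hG hx hw).2
  rw [dist_eq_norm]
  change _ ≤ _ + G * _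
  linarith

end Primal

/-! ### One pass of the algorithm. -/

section Steps

theorem hasGradientAt_jointLoss (hnt : 0 < nt) (D : Data dx K ns nt) (u : JointVar dx dz K) :
    HasGradientAt (jointLoss D) (gradient (jointLoss D) u) u :=
  ((contDiff_jointLoss hnt D).differentiable (by norm_num) u).hasGradientAt

theorem gradient_extractor (hnt : 0 < nt) (D : Data dx K ns nt) (e : ExtractorParam dx dz)
    (c : ClassifierParam dz K) (τ : EstimatorParam dz) :
    gradient (fun e => loss D e c τ) e = (minGradient D (WithLp.toLp 2 (e, c)) τ).fst :=
  (hasGradientAt_partial_fst (hasGradientAt_partial_fst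
    (hasGradientAt_jointLoss hnt D (WithLp.toLp 2 (WithLp.toLp 2 (e, c), τ))))).gradient

theorem gradient_classifier (hnt : 0 < nt) (D : Data dx K ns nt) (e : ExtractorParam dx dz)
    (c : ClassifierParam dz K) (τ : EstimatorParam dz) :
    gradient (fun c => loss D e c τ) c = (minGradient D (WithLp.toLp 2 (e, c)) τ).snd :=
  (hasGradientAt_partial_snd (hasGradientAt_partial_fst
    (hasGradientAt_jointLoss hnt D (WithLp.toLp 2 (WithLp.toLp 2 (e, c), τ))))).gradient

theorem hasGradientAt_zeta (hnt : 0 < nt) {D : Data dx K ns nt} (hlam : D.lam ≠ 0)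
    (e : ExtractorParam dx dz) (c : ClassifierParam dz K) (τ : EstimatorParam dz) :
    HasGradientAt (fun τ => zeta D τ e)
      (D.lam⁻¹ • (gradient (jointLoss D) (WithLp.toLp 2 (WithLp.toLp 2 (e, c), τ))).snd) τ := by
  have h := (hasGradientAt_partial_snd (hasGradientAt_jointLoss hnt D
    (WithLp.toLp 2 (WithLp.toLp 2 (e, c), τ)))).hasFDerivAt
  have h2 := (h.sub_const (D.μ * sourceLoss D e c + (1 - D.μ) * targetLoss D e c)).const_mul
    D.lam⁻¹
  rw [hasGradientAt_iff_hasFDerivAt, map_smul]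
  refine h2.congr_of_eventuallyEq (Eventually.of_forall fun σ => ?_)
  change zeta D σ e = D.lam⁻¹ * (loss D e c σ - _)
  unfold loss
  field_simp
  ring

/-- As a function of `θ_T`, the loss is `λ ζ` plus a constant, whatever `θ_C` is. Hence the step
size bound `λ/ν` is the usual inverse smoothness constant of `ζ`. -/
theorem isSmoothOn_zeta (hnt : 0 < nt) {D : Data dx K ns nt} (hlam : 0 < D.lam)
    {S : ParamSets dx dz K} {ν : ℝ} (hs : IsSmoothOn (jointLoss (dz := dz) D) ν S.jointSet)
    {e : ExtractorParam dx dz} (he : e ∈ S.E) :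
    IsSmoothOn (fun τ => zeta D τ e) (ν / D.lam) S.T := by
  obtain ⟨c, hc⟩ := S.nonempty_C
  refine ⟨fun τ _ => (hasGradientAt_zeta hnt hlam.ne' e c τ).differentiableAt,
    fun τ hτ σ hσ => ?_⟩
  have h := hs.2 (WithLp.toLp 2 (WithLp.toLp 2 (e, c), τ)) ⟨⟨he, hc⟩, hτ⟩
    (WithLp.toLp 2 (WithLp.toLp 2 (e, c), σ)) ⟨⟨he, hc⟩, hσ⟩
  rw [toLp_sub_toLp_right] at h
  have h2 : ‖(WithLp.toLp 2 (0, τ - σ) : JointVar dx dz K)‖ = ‖τ - σ‖ := by simp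
  rw [h2] at h
  rw [(hasGradientAt_zeta hnt hlam.ne' e c τ).gradient,
    (hasGradientAt_zeta hnt hlam.ne' e c σ).gradient, ← smul_sub, norm_smul,
    Real.norm_of_nonneg (inv_nonneg.2 hlam.le), ← WithLp.sub_snd]
  have h3 := (norm_snd_le _).trans h
  calc D.lam⁻¹ * _ ≤ D.lam⁻¹ * (ν * ‖τ - σ‖) := by gcongr
    _ = _ := by ring

/-- The inner loop keeps `θ_T` feasible and brings it closer to every feasible `z`, in
proportion to the remaining gap to the value at `z`. -/
theorem ascent_gap (hnt : 0 < nt) {D : Data dx K ns nt} (hlam : 0 < D.lam)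
    {S : ParamSets dx dz K} {ν : ℝ} (hν : 0 < ν)
    (hs : IsSmoothOn (jointLoss (dz := dz) D) ν S.jointSet) {ηT : ℝ} (hη : 0 < ηT)
    (hην : ηT ≤ D.lam / ν) {m : ℕ} (hm : 1 ≤ m) {x : MinVar dx dz K} (hx : x ∈ S.minSet)
    {y z : EstimatorParam dz} (hy : y ∈ S.T) (hz : z ∈ S.T) :
    (ascentStep D S ηT x.fst)^[m] y ∈ S.T ∧
      loss D x.fst x.snd z - loss D x.fst x.snd ((ascentStep D S ηT x.fst)^[m] y) ≤
        D.lam / (2 * ηT * m) *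
          (‖z - y‖ ^ 2 - ‖z - (ascentStep D S ηT x.fst)^[m] y‖ ^ 2) := by
  have hsmooth := isSmoothOn_zeta hnt hlam hs hx.1
  have hηL : ηT * (ν / D.lam) ≤ 1 := by
    rw [le_div_iff₀ hν] at hην
    rw [← mul_div_assoc, div_le_one hlam]
    exact hην
  obtain ⟨h1, h2⟩ := iterate_ascent_le hsmooth S.convex_T S.nonempty_T S.compact_T hη hηL
    (fun y z => le_tangent_of_support (hasGradientAt_zeta hnt hlam.ne' x.fst x.snd y).differentiableAt
      (zeta_support hnt D x.fst y) z) hy hz m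
  refine ⟨h1, ?_⟩
  change _ * (_ * (_ - zeta D ((ascentStep D S ηT x.fst)^[m] y) x.fst)) ≤
    _ - ‖z - (ascentStep D S ηT x.fst)^[m] y‖ ^ 2 at h2
  set v := (ascentStep D S ηT x.fst)^[m] y
  have hm0 : (0 : ℝ) < m := by exact_mod_cast hm
  calc loss D x.fst x.snd z - loss D x.fst x.snd v
      = D.lam / (2 * ηT * m) * (m * (2 * ηT * (zeta D z x.fst - zeta D v x.fst))) := by
        unfold loss
        field_simp
        ring
    _ ≤ _ := by gcongr

variable {D : Data dx K ns nt} {S : ParamSets dx dz K} {m : ℕ} {ηT η : ℝ}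

theorem gadIter_succ (p : Params dx dz K) (t : ℕ) :
    gadIter D S m ηT η η p (t + 1) = gadStep D S m ηT η η (gadIter D S m ηT η η p t) :=
  Function.iterate_succ_apply' _ _ _

theorem gadStep_T (p : Params dx dz K) :
    (gadStep D S m ηT η η p).T = (ascentStep D S ηT p.minVar.fst)^[m] p.T := rfl

theorem gadStep_minVar_mem (p : Params dx dz K) : (gadStep D S m ηT η η p).minVar ∈ S.minSet :=
  ⟨proj_mem S.nonempty_E S.compact_E _, proj_mem S.nonempty_C S.compact_C _⟩

/-- The descent step is at least as close to every feasible point as the unprojected one. -/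
theorem norm_sub_gadStep_le (hnt : 0 < nt) (p : Params dx dz K) {w : MinVar dx dz K}
    (hw : w ∈ S.minSet) :
    ‖w - (gadStep D S m ηT η η p).minVar‖ ≤
      ‖w - (p.minVar - η • minGradient D p.minVar (gadStep D S m ηT η η p).T)‖ := by
  set τ := (gadStep D S m ηT η η p).T with hτ
  have hE := norm_sub_proj_le S.nonempty_E S.compact_E S.convex_E
    (p.E - η • gradient (fun e => loss D e p.C τ) p.E) hw.1
  have hC := norm_sub_proj_le S.nonempty_C S.compact_C S.convex_C
    (p.C - η • gradient (fun c => loss D p.E c τ) p.C) hw.2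
  -- The squared norm splits over the two factors, so with a common step size the two projections
  -- act as one projection onto the product.
  refine le_of_sq_le_sq ?_ (norm_nonneg _)
  rw [WithLp.prod_norm_sq_eq_of_L2, WithLp.prod_norm_sq_eq_of_L2]
  refine add_le_add ?_ ?_
  · gcongr
    change ‖w.fst - proj S.E (p.E - η • gradient (fun e => loss D e p.C τ) p.E)‖ ≤
      ‖w.fst - (p.E - η • (minGradient D (WithLp.toLp 2 (p.E, p.C)) τ).fst)‖
    rw [← gradient_extractor hnt]
    exact hE
  · gcongr
    change ‖w.snd - proj S.C (p.C - η • gradient (fun c => loss D p.E c τ) p.C)‖ ≤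
      ‖w.snd - (p.C - η • (minGradient D (WithLp.toLp 2 (p.E, p.C)) τ).snd)‖
    rw [← gradient_classifier hnt]
    exact hC

end Steps

/-- Used on one block: `t * a` is the drift since its start, and `r` the weighted squared distance
of `θ_T` to the fixed competitor. -/
theorem sum_le_of_telescoping {δ r : ℕ → ℝ} {a C : ℝ} (ha : 0 ≤ a) (hr : ∀ t, 0 ≤ r t)
    (hC : r 0 ≤ C) (h : ∀ t : ℕ, δ t ≤ t * a + (r t - r (t + 1))) (B : ℕ) :
    ∑ t ∈ Finset.range B, δ t ≤ B * (B * a) + C := by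
  have h1 : ∑ t ∈ Finset.range B, δ t ≤
      ∑ t ∈ Finset.range B, ((B : ℝ) * a + (r t - r (t + 1))) := by
    refine Finset.sum_le_sum fun t ht => (h t).trans ?_
    have : (t : ℝ) ≤ B := by exact_mod_cast (Finset.mem_range.1 ht).le
    gcongr
  rw [Finset.sum_add_distrib, Finset.sum_range_sub', Finset.sum_const, Finset.card_range,
    nsmul_eq_mul] at h1
  linarith [hr B]

end GAD

/-! ### Assembly of the convergence proof. -/

theorem theorem2 {dx dz K ns nt : ℕ} (hns : 0 < ns) (hnt : 0 < nt)
    (D : GAD.Data dx K ns nt) (hμ : D.μ ∈ Set.Ioo (0 : ℝ) 1) (hlam : 0 < D.lam)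
    (S : GAD.ParamSets dx dz K) (m : ℕ) (hm : 1 ≤ m) :
    -- the objective is `ν`-smooth on the feasible set for some `ν`
    (∃ ν : ℝ, 0 < ν ∧ GAD.IsSmoothOn (GAD.jointLoss (dz := dz) D) ν S.jointSet) ∧
    -- for every such `ν`, training with suitable step sizes reaches `ε`-stationary points
    ∀ ν : ℝ, 0 < ν → GAD.IsSmoothOn (GAD.jointLoss (dz := dz) D) ν S.jointSet →
      ∀ ε : ℝ, 0 < ε → ∀ ηT : ℝ, 0 < ηT → ηT ≤ D.lam / ν →
        ∃ ηmax : ℝ, 0 < ηmax ∧ ∀ η : ℝ, 0 < η → η ≤ ηmax →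
          ∃ N : ℕ, 0 < N ∧ ∀ p : GAD.Params dx dz K, p.E ∈ S.E → p.C ∈ S.C → p.T ∈ S.T →
            (∃ t < N, GAD.IsStationary D S ν ε (GAD.gadIter D S m ηT η η p t).minVar) ∧
            (∀ t, DifferentiableAt ℝ (GAD.moreau D S ν)
              (GAD.gadIter D S m ηT η η p t).minVar) ∧
            ∀ n : ℕ, N ≤ n →
              (1 / (n : ℝ)) * ∑ t ∈ Finset.range n,
                ‖gradient (GAD.moreau D S ν) (GAD.gadIter D S m ηT η η p t).minVar‖ ^ 2
                  ≤ ε ^ 2 := by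
  have hF := GAD.contDiff_jointLoss (dz := dz) hnt D
  refine ⟨GAD.exists_isSmoothOn_of_contDiff hF (GAD.convex_jointSet S) (GAD.isCompact_jointSet S),
    fun ν hν hs ε hε ηT hηT hηTν => ?_⟩
  obtain ⟨G, hG0, hgrad, hlip⟩ :=
    GAD.exists_gradient_bound hF (GAD.convex_jointSet S) (GAD.isCompact_jointSet S)
  have hcompact := GAD.isCompact_minSet S
  have hconv := GAD.strongConvexOn_primal hnt hs
  have hcont := GAD.continuousOn_primal hnt hG0 hlip
  obtain ⟨b, hb⟩ := hcompact.exists_bound_of_continuousOn hcont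
  have hmoreau : GAD.moreau D S ν = GAD.envelope S.minSet (GAD.primal D S) ν := rfl
  have hne : S.minSet.Nonempty := by
    obtain ⟨e, he⟩ := S.nonempty_E
    obtain ⟨c, hc⟩ := S.nonempty_C
    exact ⟨WithLp.toLp 2 (e, c), he, hc⟩
  have hb0 : 0 ≤ b := (norm_nonneg _).trans (hb _ hne.some_mem)
  have hdiff : ∀ x, DifferentiableAt ℝ (GAD.moreau D S ν) x := fun x => by
    obtain ⟨_, _, _, _, h⟩ :=
      GAD.exists_hasGradientAt_envelope hν.le hcompact hne hconv hcont x
    exact h.differentiableAt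
  have hm0 : (0 : ℝ) < m := by exact_mod_cast hm
  set c := D.lam / (2 * ηT * m) with hc
  have hc0 : 0 ≤ c := by positivity
  set R := Metric.diam S.T
  -- `2 * b` bounds the oscillation of the envelope on the feasible set, and `c * R ^ 2` the
  -- telescoped distances in a block; neither depends on the starting point.
  obtain ⟨ηmax, hηmax, hstep⟩ := GAD.exists_stepsize (ν := ν) (G := G) (C := c * R ^ 2)
    (Ω := 2 * b) (ε := ε ^ 2) hν.le (by positivity) (by positivity) (by positivity)
  refine ⟨ηmax, hηmax, fun η hη hηm => ?_⟩
  obtain ⟨N, hN, hav⟩ := hstep η hη hηm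
  refine ⟨N, hN, fun p hpE hpC hpT => ?_⟩
  set q := GAD.gadIter D S m ηT η η p with hq
  have hsucc : ∀ t, q (t + 1) = GAD.gadStep D S m ηT η η (q t) := GAD.gadIter_succ p
  set x : ℕ → GAD.MinVar dx dz K := fun t => (q t).minVar with hx
  have hxS : ∀ t, x t ∈ S.minSet := by
    rintro (_ | t)
    · exact ⟨hpE, hpC⟩
    · simp only [hx, hsucc]
      exact GAD.gadStep_minVar_mem _
  have hTsucc : ∀ t, (q (t + 1)).T = (GAD.ascentStep D S ηT (x t).fst)^[m] (q t).T := by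
    intro t
    rw [hsucc, GAD.gadStep_T]
  have hT : ∀ t, (q t).T ∈ S.T := by
    intro t
    induction t with
    | zero => exact hpT
    | succ t ih =>
      rw [hTsucc]
      exact (GAD.ascent_gap hnt hlam hν hs hηT hηTν hm (hxS t) ih ih).1
  have hgap : ∀ t, ∀ z ∈ S.T, GAD.loss D (x t).fst (x t).snd z -
      GAD.loss D (x t).fst (x t).snd (q (t + 1)).T ≤
        c * (‖z - (q t).T‖ ^ 2 - ‖z - (q (t + 1)).T‖ ^ 2) := by
    intro t z hz
    rw [hTsucc]
    exact (GAD.ascent_gap hnt hlam hν hs hηT hηTν hm (hxS t) (hT t) hz).2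
  have hgnorm : ∀ t, ‖GAD.minGradient D (x t) (q (t + 1)).T‖ ≤ G := fun t =>
    (GAD.norm_fst_le _).trans (hgrad _ ⟨hxS t, hT _⟩)
  have hproj : ∀ t, ∀ w ∈ S.minSet, ‖w - x (t + 1)‖ ≤
      ‖w - (x t - η • GAD.minGradient D (x t) (q (t + 1)).T)‖ := by
    intro t w hw
    have := GAD.norm_sub_gadStep_le (D := D) (m := m) (ηT := ηT) (η := η) hnt (q t) hw
    rw [← hsucc] at this
    exact this
  have hmove : ∀ t, ‖x t - x (t + 1)‖ ≤ η * G := by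
    intro t
    refine (hproj t _ (hxS t)).trans ?_
    rw [sub_sub_cancel, norm_smul, Real.norm_of_nonneg hη.le]
    gcongr
    exact hgnorm t
  have hdist : ∀ s t : ℕ, ‖x s - x (s + t)‖ ≤ t * (η * G) := by
    intro s t
    induction t with
    | zero => simp
    | succ t ih =>
      have := (norm_sub_le_norm_sub_add_norm_sub (x s) (x (s + t)) (x (s + t + 1))).trans
        (add_le_add ih (hmove _))
      push_cast
      rw [← add_assoc]
      linarith
  -- The index `t + 1` on `θ_T` is right: the descent step from `x t` uses the estimator already
  -- updated in that pass.
  set δ : ℕ → ℝ := fun t =>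
    GAD.primal D S (x t) - GAD.loss D (x t).fst (x t).snd (q (t + 1)).T with hδ
  have hdescent : ∀ t, GAD.moreau D S ν (x (t + 1)) ≤ GAD.moreau D S ν (x t) +
      2 * ν * η * δ t - η / 2 * ‖gradient (GAD.moreau D S ν) (x t)‖ ^ 2 +
        ν * η ^ 2 * G ^ 2 := by
    intro t
    refine GAD.envelope_descent hν hη.le hcompact hconv hcont (hxS t) (hgnorm t)
      (fun w hw => ?_) (hproj t)
    have := GAD.primal_subgradient hnt hs (hxS t) hw (hT (t + 1))
    simp only [hδ]
    linarith
  have hosc : ∀ t, GAD.moreau D S ν (x 0) - GAD.moreau D S ν (x t) ≤ 2 * b := by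
    intro t
    have hlow : ∀ w ∈ S.minSet, -b ≤ GAD.primal D S w := fun w hw => (abs_le.1 (hb w hw)).1
    have h1 : GAD.moreau D S ν (x 0) ≤ b := by
      have := GAD.envelope_le hν.le hlow (x 0) (hxS 0)
      rw [sub_self, norm_zero] at this
      have h2 := (abs_le.1 (hb _ (hxS 0))).2
      rw [hmoreau]
      linarith
    have h2 : -b ≤ GAD.moreau D S ν (x t) := GAD.le_envelope hne fun w hw =>
      (hlow w hw).trans (le_add_of_nonneg_right (by positivity))
    linarith
  have hblock : ∀ s B : ℕ, ∑ t ∈ Finset.range B, δ (s + t) ≤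
      B * (B * (2 * η * G ^ 2)) + c * R ^ 2 := by
    intro s B
    -- The competitor is a maximizer at the start of the block and stays fixed throughout it, as
    -- telescoping requires.
    obtain ⟨z, hz, hzmax⟩ := GAD.exists_primal_eq hnt D S (x s)
    refine GAD.sum_le_of_telescoping (δ := fun t => δ (s + t))
      (r := fun t => c * ‖z - (q (s + t)).T‖ ^ 2) (by positivity) (fun t => by positivity)
      ?_ (fun t => ?_) B
    · gcongr
      rw [← dist_eq_norm]
      exact Metric.dist_le_diam_of_mem S.compact_T.isBounded hz (hT _)
    -- The Lipschitz bound is used twice, for the primal function and for the loss at `z`, each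
    -- costing `G * (t * (η * G))`; hence the factor `2`.
    · have h1 := (GAD.primal_sub_le hnt hlip (hxS (s + t)) (hxS s)).2
      have h2 := (GAD.primal_sub_le hnt hlip (hxS s) (hxS (s + t))).1 z hz
      have h3 := hgap (s + t) z hz
      have h4 := mul_le_mul_of_nonneg_left (hdist s t) hG0
      rw [norm_sub_rev] at h1
      simp only [hδ, ← add_assoc]
      linarith
  have hmean := hav (fun t => GAD.moreau D S ν (x t))
    (fun t => ‖gradient (GAD.moreau D S ν) (x t)‖ ^ 2) δ hdescent hosc
    (fun t => sub_nonneg.2 (GAD.loss_le_primal hnt D S (x t) (hT (t + 1)))) hblock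
  refine ⟨?_, fun t => hdiff _, hmean⟩
  -- Some term among the first `N` is at most their mean.
  obtain ⟨t, ht, hle⟩ := Finset.exists_le_of_sum_le
    (s := Finset.range N) (f := fun t => ‖gradient (GAD.moreau D S ν) (x t)‖ ^ 2)
    (g := fun _ => ε ^ 2) (Finset.nonempty_range_iff.2 hN.ne') (by
      have := hmean N le_rfl
      have hN' : (0 : ℝ) < N := by exact_mod_cast hN
      rw [one_div_mul_eq_div, div_le_iff₀ hN'] at this
      simpa [mul_comm] using this)
  exact ⟨t, Finset.mem_range.1 ht, hxS t, hdiff _, le_of_sq_le_sq hle hε.le⟩
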